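/- Let $R$ be an ordered field, $n \ge 0$, and let $P \subset R^n$ be a polytope, i.e. the convex hull of a finite set of points. A face of $P$ is a set that is either empty or the set of all points of $P$ that minimize some linear function $x \mapsto \langle c, x\rangle$ ($c \in R^n$) over $P$. The face lattice of $P$ is the set of all faces of $P$ (including $\emptyset$ and $P$) ordered by inclusion. The dimension of a nonempty face is the dimension of its affine hull, and $\dim \emptyset = -1$. Then: 1. If $F \subseteq F'$ are faces of $P$ with $\dim F' = \dim F + 2$, then there are exactly two faces $G$ of $P$ with $F \subsetneq G \subsetneq F'$, and the interval $[F, F'] = \{G \text{ a face of } P : F \subseteq G \subseteq F'\}$ is a diamond, i.e. it is isomorphic as an ordered set to $\{0,1\}^2$ with the componentwise order. 2. Every interval $[F, F']$ of the face lattice of $P$ of height $2$ (that is, whose longest chains $G_0 \subsetneq G_1 \subsetneq \dots \subsetneq G_k$ have $k = 2$) is a diamond. -/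

import Mathlib

/-- A polytope in `Rⁿ` over an ordered field `R`: the convex hull of a finite set of points. -/
def IsPolytope {R : Type*} [Field R] [LinearOrder R] {n : ℕ} (P : Set (Fin n → R)) : Prop :=
  ∃ V : Finset (Fin n → R), P = convexHull R (V : Set (Fin n → R))

/-- `F` is a face of `P` if `F` is empty, or `F` is the set of the points of `P` that minimize
some linear function `x ↦ ⟨c, x⟩` over `P`. -/
def IsFace {R : Type*} [Field R] [LinearOrder R] {n : ℕ} (P F : Set (Fin n → R)) : Prop :=
  F = ∅ ∨ ∃ c : Fin n → R, F = {x | x ∈ P ∧ ∀ y ∈ P, c ⬝ᵥ x ≤ c ⬝ᵥ y}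

/-- The face lattice of `P`: the set of all faces of `P` (including the empty face and `P`),
ordered by inclusion, the order being the one of the subtype. -/
abbrev FaceLattice {R : Type*} [Field R] [LinearOrder R] {n : ℕ} (P : Set (Fin n → R)) : Type _ :=
  {F : Set (Fin n → R) // IsFace P F}

open Classical in
/-- The dimension of a set of points: the dimension of (the direction of) its affine hull,
and `-1` for the empty set. -/
noncomputable def setDim {R : Type*} [Field R] {n : ℕ} (S : Set (Fin n → R)) : ℤ :=
  if S = ∅ then -1 else (Module.finrank R (affineSpan R S).direction : ℤ)

/-! Lift each point `v` of `V` to `(v, 1)`. Faces of the polytope become zero sets on `V` of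
functionals nonnegative on all lifted points (`faceLatticeOrderIso`), and dimension plus one becomes
the rank of a linear span. Let `S ⊆ T` be such zero sets with rank difference 2, and let `ℓ` define
`S`. The functionals vanishing on `S`, modulo those vanishing on `T`, form a plane spanned by `ℓ`
and some `μ` (`exists_tilt`). Those nonnegative on `T` form a planar cone with `ℓ` in its interior;
its two boundary rays, found as the extreme slopes of `μ` against `ℓ`, cut out the only two faces
strictly between (`IsConeFace.exists_two_between`). Height 2 reduces to rank difference 2, because a
rank jump of at least 2 always admits an intermediate face (`IsConeFace.exists_between`). -/

/-! ### Posets with a rank function -/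

section Poset

variable {L : Type*} [PartialOrder L]

/-- An interval with exactly two interior elements, which are incomparable, is a diamond. -/
theorem nonempty_Icc_orderIso_bool_prod {F F' G₁ G₂ : L} (h : Set.Ioo F F' = {G₁, G₂})
    (h₁₂ : ¬ G₁ ≤ G₂) (h₂₁ : ¬ G₂ ≤ G₁) : Nonempty (Set.Icc F F' ≃o Bool × Bool) := by
  have m₁ : G₁ ∈ Set.Ioo F F' := by simp [h]
  have m₂ : G₂ ∈ Set.Ioo F F' := by simp [h]
  have hF : F < F' := m₁.1.trans m₁.2
  let f : Bool × Bool → Set.Icc F F' := fun p => match p with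
    | (false, false) => ⟨F, le_rfl, hF.le⟩
    | (true, false) => ⟨G₁, m₁.1.le, m₁.2.le⟩
    | (false, true) => ⟨G₂, m₂.1.le, m₂.2.le⟩
    | (true, true) => ⟨F', hF.le, le_rfl⟩
  have htf : ¬ true ≤ false := by decide
  have hf : ∀ p q, f p ≤ f q ↔ p ≤ q := by
    rintro ⟨_ | _, _ | _⟩ ⟨_ | _, _ | _⟩ <;>
      simp [f, ← Subtype.coe_le_coe, htf, h₁₂, h₂₁, m₁.1.le, m₁.2.le, m₂.1.le, m₂.2.le, hF.le,
        m₁.1.not_ge, m₁.2.not_ge, m₂.1.not_ge, m₂.2.not_ge, hF.not_ge]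
  have hs : Function.Surjective f := by
    rintro ⟨G, h₁, h₂⟩
    rcases h₁.eq_or_lt with rfl | h₁
    · exact ⟨(false, false), rfl⟩
    rcases h₂.eq_or_lt with rfl | h₂
    · exact ⟨(true, true), rfl⟩
    have hG : G ∈ ({G₁, G₂} : Set L) := h ▸ ⟨h₁, h₂⟩
    rcases hG with rfl | hG
    · exact ⟨(true, false), rfl⟩
    · exact ⟨(false, true), Subtype.ext hG.symm⟩
  exact ⟨(RelIso.ofSurjective (OrderEmbedding.ofMapLEIff f hf) hs).symm⟩

/-- If the rank function has no jumps, an interval of height `2` has rank difference `2`. -/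
theorem rank_eq_add_two_of_krullDim_Icc_eq_two {r : L → ℕ} (hr : StrictMono r)
    (hgap : ∀ F F', F ≤ F' → r F + 2 ≤ r F' → ∃ G, F < G ∧ G < F') {F F' : L}
    (h : Order.krullDim (Set.Icc F F') = 2) : F ≤ F' ∧ r F' = r F + 2 := by
  obtain ⟨l, hl⟩ := (Order.le_krullDim_iff (n := 2)).1 h.symm.le
  have h01 : l ⟨0, by omega⟩ < l ⟨1, by omega⟩ := l.strictMono (Fin.mk_lt_mk.2 (by omega))
  have h12 : l ⟨1, by omega⟩ < l ⟨2, by omega⟩ := l.strictMono (Fin.mk_lt_mk.2 (by omega))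
  have a := hr (show (l ⟨0, by omega⟩ : L) < l ⟨1, by omega⟩ from h01)
  have b := hr (show (l ⟨1, by omega⟩ : L) < l ⟨2, by omega⟩ from h12)
  have c := hr.monotone (l ⟨0, by omega⟩).2.1
  have d := hr.monotone (l ⟨2, by omega⟩).2.2
  have hle : F ≤ F' := (l ⟨0, by omega⟩).2.1.trans (l ⟨0, by omega⟩).2.2
  refine ⟨hle, ?_⟩
  by_contra hne
  have chain : ∀ G H : L, F < G → G < H → H < F' → False := by
    intro G H h₁ h₂ h₃
    let s : LTSeries (Set.Icc F F') := ⟨3, ![⟨F, le_rfl, hle⟩, ⟨G, h₁.le, (h₂.trans h₃).le⟩,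
      ⟨H, (h₁.trans h₂).le, h₃.le⟩, ⟨F', hle, le_rfl⟩], by
        intro i
        fin_cases i
        · exact h₁
        · exact h₂
        · exact h₃⟩
    have := (Order.le_krullDim_iff (n := 3)).2 ⟨s, rfl⟩
    rw [h] at this
    exact absurd this (by decide)
  obtain ⟨G, h₁, h₂⟩ := hgap F F' hle (by omega)
  -- The total jump is now at least 3, so one of the two halves still jumps by at least 2 and can be
  -- refined.
  by_cases hG : r F + 2 ≤ r G
  · obtain ⟨H, h₃, h₄⟩ := hgap F G h₁.le hG
    exact chain H G h₃ h₄ h₂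
  · obtain ⟨H, h₃, h₄⟩ := hgap G F' h₂.le (by omega)
    exact chain G H h₁ h₃ h₄

end Poset

/-! ### Faces of finite vector configurations -/

section ConeFace

open Module

variable {R : Type*} [Field R] {ι E : Type*} [AddCommGroup E] [Module R E]

/-- The rank of a subset of a vector configuration. -/
noncomputable def coneRank (R : Type*) [Field R] {ι E : Type*} [AddCommGroup E] [Module R E]
    (w : ι → E) (S : Set ι) : ℕ :=
  finrank R (Submodule.span R (w '' S))

theorem mem_dualAnnihilator_span_image {w : ι → E} {S : Set ι} {φ : Dual R E} :
    φ ∈ (Submodule.span R (w '' S)).dualAnnihilator ↔ ∀ i ∈ S, φ (w i) = 0 := by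
  rw [Submodule.mem_dualAnnihilator]
  refine ⟨fun h i hi => h _ (Submodule.subset_span ⟨i, hi, rfl⟩), fun h x hx => ?_⟩
  have : Submodule.span R (w '' S) ≤ LinearMap.ker φ := by
    rw [Submodule.span_le]
    rintro _ ⟨i, hi, rfl⟩
    exact h i hi
  exact this hx

/-- In a pair of faces of rank difference at least `2` there is a functional vanishing on the
smaller face that is not proportional on the larger face to the one defining the smaller face;
if the rank difference is `2`, these two functionals span everything. -/
theorem exists_tilt [FiniteDimensional R E] {w : ι → E} {T : Set ι} {ℓ : Dual R E}
    (hST : {i | ℓ (w i) = 0} ⊆ T)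
    (hr : coneRank R w {i | ℓ (w i) = 0} + 2 ≤ coneRank R w T) :
    ∃ μ : Dual R E, (∀ i, ℓ (w i) = 0 → μ (w i) = 0) ∧
      (∀ t : R, ∃ i ∈ T, (μ - t • ℓ) (w i) ≠ 0) ∧
      (coneRank R w T = coneRank R w {i | ℓ (w i) = 0} + 2 → ∀ ν : Dual R E,
        (∀ i, ℓ (w i) = 0 → ν (w i) = 0) →
          ∃ a b : R, ∀ i ∈ T, ν (w i) = a * ℓ (w i) + b * μ (w i)) := by
  set A := Submodule.span R (w '' {i | ℓ (w i) = 0}) with hA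
  set B := Submodule.span R (w '' T) with hB
  have hAB : B.dualAnnihilator ≤ A.dualAnnihilator :=
    Submodule.dualAnnihilator_anti (Submodule.span_mono (Set.image_mono hST))
  have dA := Subspace.finrank_add_finrank_dualAnnihilator_eq A
  have dB := Subspace.finrank_add_finrank_dualAnnihilator_eq B
  have hr' : finrank R A + 2 ≤ finrank R B := hr
  have hℓA : ℓ ∈ A.dualAnnihilator := mem_dualAnnihilator_span_image.2 fun _ hi => hi
  have hℓB : ℓ ∉ B.dualAnnihilator := by
    intro h
    have : A.dualAnnihilator ≤ B.dualAnnihilator := by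
      refine Submodule.dualAnnihilator_anti (Submodule.span_mono (Set.image_mono ?_))
      exact fun i hi => mem_dualAnnihilator_span_image.1 h i hi
    have := Submodule.finrank_mono this
    omega
  have d1 := Submodule.finrank_sup_span_singleton hℓB
  have hle : B.dualAnnihilator ⊔ R ∙ ℓ ≤ A.dualAnnihilator :=
    sup_le hAB ((Submodule.span_singleton_le_iff_mem _ _).2 hℓA)
  -- Annihilator dimensions differ by the rank difference, at least 2, while adjoining `ℓ` accounts
  -- for only 1.
  obtain ⟨μ, hμA, hμ⟩ : ∃ μ ∈ A.dualAnnihilator, μ ∉ B.dualAnnihilator ⊔ R ∙ ℓ := by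
    by_contra! h
    have := Submodule.finrank_mono (show A.dualAnnihilator ≤ _ from h)
    omega
  refine ⟨μ, fun i hi => mem_dualAnnihilator_span_image.1 hμA i hi, fun t => ?_, ?_⟩
  · by_contra! h
    refine hμ (Submodule.mem_sup.2 ⟨μ - t • ℓ, mem_dualAnnihilator_span_image.2 h, t • ℓ,
      Submodule.smul_mem _ _ (Submodule.mem_span_singleton_self _), by simp⟩)
  · intro heq ν hν
    have heq' : finrank R B = finrank R A + 2 := heq
    have d2 := Submodule.finrank_sup_span_singleton hμ
    have htop : (B.dualAnnihilator ⊔ R ∙ ℓ) ⊔ R ∙ μ = A.dualAnnihilator :=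
      Submodule.eq_of_le_of_finrank_eq
        (sup_le hle ((Submodule.span_singleton_le_iff_mem _ _).2 hμA)) (by omega)
    have hνA : ν ∈ A.dualAnnihilator := mem_dualAnnihilator_span_image.2 hν
    rw [← htop] at hνA
    obtain ⟨x, hx, y, hy, rfl⟩ := Submodule.mem_sup.1 hνA
    obtain ⟨β, hβ, z, hz, rfl⟩ := Submodule.mem_sup.1 hx
    obtain ⟨a, rfl⟩ := Submodule.mem_span_singleton.1 hz
    obtain ⟨b, rfl⟩ := Submodule.mem_span_singleton.1 hy
    refine ⟨a, b, fun i hi => ?_⟩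
    simp [mem_dualAnnihilator_span_image.1 hβ i hi]

theorem setOf_ssubset_of_exists_slope {w : ι → E} {T : Set ι} {ℓ μ : Dual R E} {t : R}
    (hST : {i | ℓ (w i) = 0} ⊆ T) (hμ : ∀ i, ℓ (w i) = 0 → μ (w i) = 0)
    (h₁ : ∃ i ∈ T, ℓ (w i) ≠ 0 ∧ (μ - t • ℓ) (w i) = 0)
    (h₂ : ∃ i ∈ T, (μ - t • ℓ) (w i) ≠ 0) :
    {i | ℓ (w i) = 0} ⊂ {i | i ∈ T ∧ (μ - t • ℓ) (w i) = 0} ∧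
      {i | i ∈ T ∧ (μ - t • ℓ) (w i) = 0} ⊂ T := by
  obtain ⟨i, hiT, hi, hi'⟩ := h₁
  obtain ⟨j, hjT, hj⟩ := h₂
  refine ⟨Set.ssubset_iff_exists.2 ⟨fun k hk => ⟨hST hk, ?_⟩, i, ⟨hiT, hi'⟩, hi⟩,
    Set.ssubset_iff_exists.2 ⟨fun k hk => hk.1, j, hjT, fun h => hj h.2⟩⟩
  have hk : ℓ (w k) = 0 := hk
  simp [hk, hμ k hk]

variable [LinearOrder R]

/-- A face of a vector configuration: the zero set of a linear functional that is nonnegative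
on the configuration. -/
def IsConeFace (w : ι → E) (S : Set ι) : Prop :=
  ∃ ℓ : Dual R E, (∀ i, 0 ≤ ℓ (w i)) ∧ S = {i | ℓ (w i) = 0}

/-- If the spans agreed, the functional defining `S` would vanish on all of `T`. -/
theorem IsConeFace.coneRank_lt [FiniteDimensional R E] {w : ι → E} {S T : Set ι}
    (hS : IsConeFace (R := R) w S) (h : S ⊂ T) : coneRank R w S < coneRank R w T := by
  obtain ⟨ℓ, -, rfl⟩ := hS
  obtain ⟨i, hiT, hi⟩ := Set.exists_of_ssubset h
  refine Submodule.finrank_lt_finrank_of_lt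
    (lt_of_le_of_ne (Submodule.span_mono (Set.image_mono h.1)) fun he => hi ?_)
  have h0 : ℓ ∈ (Submodule.span R (w '' {i | ℓ (w i) = 0})).dualAnnihilator :=
    mem_dualAnnihilator_span_image.2 fun _ hj => hj
  rw [he, mem_dualAnnihilator_span_image] at h0
  exact h0 i hiT

variable [IsStrictOrderedRing R]

/-- A face of a face is a face. -/
theorem IsConeFace.trans [Finite ι] {w : ι → E} {T : Set ι} (hT : IsConeFace (R := R) w T)
    {ν : Dual R E} (hν : ∀ i ∈ T, 0 ≤ ν (w i)) :
    IsConeFace (R := R) w {i | i ∈ T ∧ ν (w i) = 0} := by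
  obtain ⟨ℓ, hℓ, rfl⟩ := hT
  -- A large multiple of `ℓ` outweighs `ν` off `T`; the extra 1 in `N + 1` makes the sum strictly
  -- positive there.
  obtain ⟨N, hN⟩ := (Set.finite_range fun i => -ν (w i) / ℓ (w i)).bddAbove
  have key : ∀ i, ℓ (w i) ≠ 0 → 0 < ((N + 1) • ℓ + ν) (w i) := by
    intro i hi
    have hpos : 0 < ℓ (w i) := lt_of_le_of_ne (hℓ i) (Ne.symm hi)
    have := (div_le_iff₀ hpos).1 (hN ⟨i, rfl⟩)
    simp only [LinearMap.add_apply, LinearMap.smul_apply, smul_eq_mul]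
    nlinarith
  have key' : ∀ i, ℓ (w i) = 0 → ((N + 1) • ℓ + ν) (w i) = ν (w i) := by
    intro i hi
    simp [hi]
  refine ⟨(N + 1) • ℓ + ν, fun i => ?_, ?_⟩
  · by_cases hi : ℓ (w i) = 0
    · rw [key' i hi]
      exact hν i hi
    · exact (key i hi).le
  · ext i
    by_cases hi : ℓ (w i) = 0
    · simp only [Set.mem_ofPred_eq, key' i hi, hi, true_and]
    · simp only [Set.mem_ofPred_eq, hi, false_and, false_iff]
      exact (key i hi).ne'

/-- The minimal slope of `μ` relative to `ℓ` on the part of `T` where `ℓ` is positive. -/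
theorem exists_min_slope [Finite ι] {w : ι → E} {T : Set ι} {ℓ μ : Dual R E}
    (hℓ : ∀ i, 0 ≤ ℓ (w i)) (hμ : ∀ i, ℓ (w i) = 0 → μ (w i) = 0)
    (hT : ∃ i ∈ T, ℓ (w i) ≠ 0) :
    ∃ t : R, (∀ i ∈ T, 0 ≤ (μ - t • ℓ) (w i)) ∧
      ∃ i ∈ T, ℓ (w i) ≠ 0 ∧ (μ - t • ℓ) (w i) = 0 := by
  obtain ⟨i, ⟨hiT, hi⟩, hmin⟩ := Set.exists_min_image {i | i ∈ T ∧ ℓ (w i) ≠ 0}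
    (fun i => μ (w i) / ℓ (w i)) (Set.toFinite _) hT
  refine ⟨μ (w i) / ℓ (w i), fun j hj => ?_, i, hiT, hi, ?_⟩
  · simp only [LinearMap.sub_apply, LinearMap.smul_apply, smul_eq_mul]
    by_cases hj0 : ℓ (w j) = 0
    · simp [hj0, hμ j hj0]
    · have := hmin j ⟨hj, hj0⟩
      rw [le_div_iff₀ (lt_of_le_of_ne (hℓ j) (Ne.symm hj0))] at this
      linarith
  · simp [div_mul_cancel₀ _ hi]

theorem IsConeFace.exists_between [Finite ι] [FiniteDimensional R E] {w : ι → E} {S T : Set ι}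
    (hS : IsConeFace (R := R) w S) (hT : IsConeFace (R := R) w T) (hST : S ⊆ T)
    (hr : coneRank R w S + 2 ≤ coneRank R w T) :
    ∃ G, IsConeFace (R := R) w G ∧ S ⊂ G ∧ G ⊂ T := by
  obtain ⟨ℓ, hℓ, rfl⟩ := hS
  obtain ⟨μ, hμ, hne, -⟩ := exists_tilt hST hr
  have hex : ∃ i ∈ T, ℓ (w i) ≠ 0 := by
    obtain ⟨i, hi, h⟩ := hne 0
    exact ⟨i, hi, fun h0 => h (by simp [hμ i h0])⟩
  obtain ⟨t, ht, hti⟩ := exists_min_slope hℓ hμ hex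
  exact ⟨_, hT.trans ht, setOf_ssubset_of_exists_slope hST hμ hti (hne t)⟩

theorem IsConeFace.exists_two_between [Finite ι] [FiniteDimensional R E] {w : ι → E}
    {S T : Set ι} (hS : IsConeFace (R := R) w S) (hT : IsConeFace (R := R) w T) (hST : S ⊆ T)
    (hr : coneRank R w T = coneRank R w S + 2) :
    ∃ G₁ G₂, G₁ ≠ G₂ ∧ ∀ G, (IsConeFace (R := R) w G ∧ S ⊂ G ∧ G ⊂ T) ↔ G = G₁ ∨ G = G₂ := by
  obtain ⟨ℓ, hℓ, rfl⟩ := hS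
  obtain ⟨μ, hμ, hne, hspan⟩ := exists_tilt hST hr.ge
  specialize hspan hr
  have hex : ∃ i ∈ T, ℓ (w i) ≠ 0 := by
    obtain ⟨i, hi, h⟩ := hne 0
    exact ⟨i, hi, fun h0 => h (by simp [hμ i h0])⟩
  obtain ⟨t, ht, hti⟩ := exists_min_slope hℓ hμ hex
  -- The minimal slope of `-μ` is minus the maximal slope of `μ`, which gives the second boundary
  -- ray.
  obtain ⟨s, hs, hsi⟩ := exists_min_slope (μ := -μ) hℓ (fun i hi => by simp [hμ i hi]) hex
  have hne' : ∃ i ∈ T, (-μ - s • ℓ) (w i) ≠ 0 := by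
    obtain ⟨i, hi, h⟩ := hne (-s)
    refine ⟨i, hi, fun h0 => h ?_⟩
    simp only [LinearMap.sub_apply, LinearMap.smul_apply, LinearMap.neg_apply, smul_eq_mul]
      at h0 ⊢
    linarith
  have f₁ := setOf_ssubset_of_exists_slope hST hμ hti (hne t)
  have f₂ := setOf_ssubset_of_exists_slope (μ := -μ) hST (fun i hi => by simp [hμ i hi]) hsi hne'
  refine ⟨{i | i ∈ T ∧ (μ - t • ℓ) (w i) = 0}, {i | i ∈ T ∧ (-μ - s • ℓ) (w i) = 0}, ?_,
    fun G => ⟨?_, ?_⟩⟩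
  rotate_left 2
  · rintro (rfl | rfl)
    exacts [⟨hT.trans ht, f₁⟩, ⟨hT.trans hs, f₂⟩]
  · obtain ⟨i, hiT, hi, hi0⟩ := hti
    obtain ⟨j, hjT, hj⟩ := hne t
    intro heq
    have h1 : i ∈ {i | i ∈ T ∧ (-μ - s • ℓ) (w i) = 0} := heq ▸ ⟨hiT, hi0⟩
    have h2 := h1.2
    simp only [LinearMap.sub_apply, LinearMap.smul_apply, LinearMap.neg_apply, smul_eq_mul]
      at h2 hi0 hj ht hs
    -- If the two faces coincided, the extreme slopes would be equal, forcing `μ = t • ℓ` on `T`.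
    have hst : s = -t := by
      have : (s + t) * ℓ (w i) = 0 := by linear_combination -h2 - hi0
      rcases mul_eq_zero.1 this with h | h
      · linarith
      · exact absurd h hi
    have a := ht j hjT
    have b := hs j hjT
    rw [hst] at b
    exact hj (by linarith)
  · rintro ⟨⟨ν, hν, rfl⟩, h₁, h₂⟩
    obtain ⟨a, b, hab⟩ := hspan ν (fun i hi => h₁.1 hi)
    obtain ⟨k, hk, hkℓ⟩ := Set.exists_of_ssubset h₁
    have hkT := h₂.1 hk
    have hkpos : 0 < ℓ (w k) := lt_of_le_of_ne (hℓ k) (Ne.symm hkℓ)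
    have hk0 : a * ℓ (w k) + b * μ (w k) = 0 := by rw [← hab k hkT]; exact hk
    have hG : ∀ i, ν (w i) = 0 ↔ i ∈ T ∧ a * ℓ (w i) + b * μ (w i) = 0 := fun i =>
      ⟨fun h => ⟨h₂.1 h, by rw [← hab i (h₂.1 h)]; exact h⟩, fun h => by rw [hab i h.1]; exact h.2⟩
    have hnn : ∀ i ∈ T, 0 ≤ a * ℓ (w i) + b * μ (w i) := fun i hi => hab i hi ▸ hν i
    simp only [LinearMap.sub_apply, LinearMap.smul_apply, LinearMap.neg_apply, smul_eq_mul]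
      at ht hti hs hsi ⊢
    -- The sign of `b` selects the boundary ray. A zero of `ν` outside `S` and the point attaining
    -- the extreme slope bound `a` from the two sides; `b = 0` would make `ν` vanish on `T`.
    rcases lt_trichotomy b 0 with hb | rfl | hb
    · right
      obtain ⟨i, hiT, hi, hi0⟩ := hsi
      have hipos : 0 < ℓ (w i) := lt_of_le_of_ne (hℓ i) (Ne.symm hi)
      have e : a = b * s := by
        apply le_antisymm
        · refine le_of_mul_le_mul_right ?_ hkpos
          nlinarith [hs k hkT]
        · refine le_of_mul_le_mul_right ?_ hipos
          nlinarith [hnn i hiT]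
      ext l
      simp only [Set.mem_ofPred_eq, hG l, e]
      refine and_congr_right fun _ => ?_
      rw [show b * s * ℓ (w l) + b * μ (w l) = -b * (-μ (w l) - s * ℓ (w l)) by ring, mul_eq_zero,
        or_iff_right (neg_ne_zero.2 hb.ne)]
    · exfalso
      have ha : a = 0 := by
        rw [zero_mul, add_zero] at hk0
        exact (mul_eq_zero.1 hk0).resolve_right hkℓ
      refine h₂.2 fun i hi => ?_
      simp [hG i, hi, ha]
    · left
      obtain ⟨i, hiT, hi, hi0⟩ := hti
      have hipos : 0 < ℓ (w i) := lt_of_le_of_ne (hℓ i) (Ne.symm hi)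
      have e : a = -b * t := by
        apply le_antisymm
        · refine le_of_mul_le_mul_right ?_ hkpos
          nlinarith [ht k hkT]
        · refine le_of_mul_le_mul_right ?_ hipos
          nlinarith [hnn i hiT]
      ext l
      simp only [Set.mem_ofPred_eq, hG l, e]
      refine and_congr_right fun _ => ?_
      rw [show -b * t * ℓ (w l) + b * μ (w l) = b * (μ (w l) - t * ℓ (w l)) by ring, mul_eq_zero,
        or_iff_right hb.ne']

end ConeFace

/-! ### Homogenization of a polytope -/

section Homogenize

variable {R : Type*} [Field R] {n : ℕ}

/-- The point `x` of `Rⁿ` as the vector `(x, 1)`. -/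
def homogenize (x : Fin n → R) : (Fin n → R) × R := (x, 1)

/-- The span splits as the direction space at height 0 plus one lifted point. The convention `setDim
∅ = -1` matches rank 0. -/
theorem coneRank_homogenize {V : Type*} (f : V → Fin n → R) (S : Set V) :
    (coneRank R (fun v => homogenize (f v)) S : ℤ) = setDim (f '' S) + 1 := by
  rcases S.eq_empty_or_nonempty with rfl | ⟨p, hp⟩
  · simp [coneRank, setDim]
  have hne : f '' S ≠ ∅ := ((Set.nonempty_of_mem hp).image f).ne_empty
  have hpS : f p ∈ f '' S := ⟨p, hp, rfl⟩
  let D := (vectorSpan R (f '' S)).map (LinearMap.inl R (Fin n → R) R)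
  have hD : ∀ x ∈ D, x.2 = 0 := by
    rintro _ ⟨y, -, rfl⟩
    rfl
  have hnot : homogenize (f p) ∉ D := fun h => one_ne_zero (hD _ h)
  have hspan : Submodule.span R ((fun v => homogenize (f v)) '' S)
      = D ⊔ Submodule.span R {homogenize (f p)} := by
    apply le_antisymm
    · rw [Submodule.span_le]
      rintro _ ⟨v, hv, rfl⟩
      refine Submodule.mem_sup.2 ⟨(f v - f p, 0), ⟨f v - f p, ?_, rfl⟩, homogenize (f p),
        Submodule.mem_span_singleton_self _, by simp [homogenize]⟩
      exact vsub_mem_vectorSpan R ⟨v, hv, rfl⟩ hpS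
    · refine sup_le ?_ ?_
      · rw [Submodule.map_le_iff_le_comap, vectorSpan_eq_span_vsub_set_right R hpS,
          Submodule.span_le]
        rintro _ ⟨_, ⟨v, hv, rfl⟩, rfl⟩
        have := Submodule.sub_mem _
          (Submodule.subset_span (R := R) (Set.mem_image_of_mem (fun v => homogenize (f v)) hv))
          (Submodule.subset_span (R := R) (Set.mem_image_of_mem (fun v => homogenize (f v)) hp))
        simpa [homogenize] using this
      · rw [Submodule.span_singleton_le_iff_mem]
        exact Submodule.subset_span ⟨p, hp, rfl⟩
  rw [coneRank, hspan, Submodule.finrank_sup_span_singleton hnot, setDim, if_neg hne,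
    direction_affineSpan, LinearEquiv.finrank_eq
      (Submodule.equivMapOfInjective _ LinearMap.inl_injective (vectorSpan R (f '' S))).symm]
  push_cast
  rfl

variable [LinearOrder R]

theorem setDim_convexHull [IsStrictOrderedRing R] (S : Set (Fin n → R)) :
    setDim (convexHull R S) = setDim S := by
  simp only [setDim, convexHull_eq_empty]
  rw [affineSpan_convexHull]

theorem dotProduct_le_of_mem_convexHull [IsStrictOrderedRing R] {V : Set (Fin n → R)}
    {c x : Fin n → R} {a : R} (h : ∀ v ∈ V, a ≤ c ⬝ᵥ v) (hx : x ∈ convexHull R V) :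
    a ≤ c ⬝ᵥ x := by
  have hc : Convex R {y : Fin n → R | a ≤ dotProductEquiv R (Fin n) c y} :=
    convex_halfSpace_ge (LinearMap.isLinear _) a
  exact convexHull_min (fun v hv => by simpa using h v hv) hc hx

/-- A face of the convex hull of `V` is the convex hull of the points of `V` it contains. -/
theorem IsFace.eq_convexHull [IsStrictOrderedRing R] {V : Finset (Fin n → R)}
    {F : Set (Fin n → R)} (hF : IsFace (convexHull R (V : Set (Fin n → R))) F) :
    F = convexHull R ((V : Set (Fin n → R)) ∩ F) := by
  rcases hF with rfl | ⟨c, rfl⟩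
  · simp
  apply subset_antisymm
  · rintro x ⟨hx, hmin⟩
    obtain ⟨a, ha, ha1, hax⟩ := Finset.mem_convexHull'.1 hx
    -- The weighted excesses over the minimum are nonnegative and sum to zero, so only minimizers
    -- carry weight.
    have hzero : ∀ v ∈ V, a v * (c ⬝ᵥ v - c ⬝ᵥ x) = 0 := by
      refine (Finset.sum_eq_zero_iff_of_nonneg fun v hv => mul_nonneg (ha v hv)
        (sub_nonneg.2 (hmin v (subset_convexHull R _ hv)))).1 ?_
      have : c ⬝ᵥ x = ∑ v ∈ V, a v * (c ⬝ᵥ v) := by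
        rw [← hax, dotProduct_sum]
        simp
      simp only [mul_sub, Finset.sum_sub_distrib, ← Finset.sum_mul, ha1, this, one_mul, sub_self]
    classical
    have hsub : ∀ v ∈ V, a v ≠ 0 → v ∈ (V : Set (Fin n → R)) ∩
        {x | x ∈ convexHull R (V : Set (Fin n → R)) ∧
          ∀ y ∈ convexHull R (V : Set (Fin n → R)), c ⬝ᵥ x ≤ c ⬝ᵥ y} := by
      intro v hv hav
      have := (mul_eq_zero.1 (hzero v hv)).resolve_left hav
      refine ⟨hv, subset_convexHull R _ hv, fun y hy => ?_⟩
      rw [sub_eq_zero.1 this]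
      exact hmin y hy
    rw [← hax, ← Finset.sum_filter_of_ne (p := fun v => a v ≠ 0)
      (fun v _ h h0 => h (by simp [h0]))]
    refine (convex_convexHull R _).sum_mem (fun v hv => ha v (Finset.mem_filter.1 hv).1) ?_
      fun v hv => subset_convexHull R _
        (hsub v (Finset.mem_filter.1 hv).1 (Finset.mem_filter.1 hv).2)
    rw [Finset.sum_filter_of_ne (fun v _ h => h), ha1]
  · intro x hx
    refine ⟨convexHull_mono Set.inter_subset_left hx, fun y hy => ?_⟩
    have := dotProduct_le_of_mem_convexHull (c := -c) (a := -(c ⬝ᵥ y)) (fun v hv => by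
      simpa using hv.2.2 y hy) hx
    simpa using this

theorem isConeFace_of_isFace [IsStrictOrderedRing R] {V : Finset (Fin n → R)}
    {F : Set (Fin n → R)} (hF : IsFace (convexHull R (V : Set (Fin n → R))) F) :
    IsConeFace (R := R) (fun v : V => homogenize (v : Fin n → R)) {v : V | (v : Fin n → R) ∈ F} := by
  by_cases hne : F = ∅
  · subst hne
    -- The height coordinate is 1 on every lifted point, so its zero set is empty.
    exact ⟨LinearMap.snd R _ _, fun _ => zero_le_one, by ext; simp [homogenize]⟩
  obtain rfl | ⟨c, rfl⟩ := hF
  · exact absurd rfl hne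
  obtain ⟨x, hx, hmin⟩ := Set.nonempty_iff_ne_empty.2 hne
  let φ : Module.Dual R ((Fin n → R) × R) :=
    (dotProductEquiv R (Fin n) c).comp (LinearMap.fst R (Fin n → R) R)
      - (c ⬝ᵥ x) • LinearMap.snd R (Fin n → R) R
  have hφ : ∀ v : Fin n → R, φ (homogenize v) = c ⬝ᵥ v - c ⬝ᵥ x := by
    intro v
    simp [φ, homogenize]
  refine ⟨φ, fun v => ?_, Set.ext fun v => ?_⟩
  · rw [hφ]
    exact sub_nonneg.2 (hmin v (subset_convexHull R _ v.2))
  · simp only [Set.mem_ofPred_eq]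
    rw [hφ, sub_eq_zero]
    exact ⟨fun h => le_antisymm (h.2 x hx) (hmin v h.1), fun h =>
      ⟨subset_convexHull R _ v.2, fun y hy => h ▸ hmin y hy⟩⟩

theorem IsConeFace.exists_isFace [IsStrictOrderedRing R] {V : Finset (Fin n → R)} {S : Set V}
    (hS : IsConeFace (R := R) (fun v : V => homogenize (v : Fin n → R)) S) :
    ∃ F, IsFace (convexHull R (V : Set (Fin n → R))) F ∧ {v : V | (v : Fin n → R) ∈ F} = S := by
  rcases S.eq_empty_or_nonempty with rfl | ⟨p, hp⟩
  · exact ⟨∅, Or.inl rfl, by simp⟩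
  obtain ⟨φ, hφ, rfl⟩ := hS
  -- On lifted points `φ` is `⟨c, ·⟩` plus a constant; since it vanishes at `p`, its zeros in `V`
  -- are the minimizers of `c`.
  let c := (dotProductEquiv R (Fin n)).symm (φ.comp (LinearMap.inl R _ R))
  have hc : ∀ v : Fin n → R, φ (homogenize v) = c ⬝ᵥ v + φ (0, 1) := by
    intro v
    have : c ⬝ᵥ v = φ (v, 0) := by
      change dotProductEquiv R (Fin n) c v = _
      simp [c]
    rw [this, ← map_add]
    simp [homogenize]
  have hp' : c ⬝ᵥ (p : Fin n → R) + φ (0, 1) = 0 := by rw [← hc]; exact hp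
  have hmin : ∀ y ∈ convexHull R (V : Set (Fin n → R)), -φ (0, 1) ≤ c ⬝ᵥ y := fun y hy =>
    dotProduct_le_of_mem_convexHull (fun v hv => by
      have := hφ ⟨v, hv⟩
      simp only [hc] at this
      linarith) hy
  refine ⟨_, Or.inr ⟨c, rfl⟩, Set.ext fun v => ?_⟩
  simp only [Set.mem_ofPred_eq, hc]
  refine ⟨fun h => ?_, fun h => ⟨subset_convexHull R _ v.2, fun y hy => ?_⟩⟩
  · have h1 := h.2 p (subset_convexHull R _ p.2)
    have h2 := hmin v (subset_convexHull R _ v.2)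
    linarith
  · have := hmin y hy
    linarith

/-- The face lattice of the convex hull of `V` is the lattice of faces of the homogenization
of `V`. -/
noncomputable def faceLatticeOrderIso [IsStrictOrderedRing R] (V : Finset (Fin n → R)) :
    FaceLattice (convexHull R (V : Set (Fin n → R))) ≃o
      {S : Set V // IsConeFace (R := R) (fun v : V => homogenize (v : Fin n → R)) S} :=
  RelIso.ofSurjective (OrderEmbedding.ofMapLEIff
    (fun F => ⟨{v : V | (v : Fin n → R) ∈ F.1}, isConeFace_of_isFace F.2⟩) fun F G => by
      refine ⟨fun h => ?_, fun h v hv => h hv⟩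
      change F.1 ⊆ G.1
      rw [F.2.eq_convexHull, G.2.eq_convexHull]
      exact convexHull_mono fun v hv => ⟨hv.1, h (show (⟨v, hv.1⟩ : V) ∈ _ from hv.2)⟩)
    fun S => by
      obtain ⟨F, hF, h⟩ := S.2.exists_isFace
      exact ⟨⟨F, hF⟩, Subtype.ext h⟩

theorem coneRank_faceLatticeOrderIso [IsStrictOrderedRing R] (V : Finset (Fin n → R))
    (F : FaceLattice (convexHull R (V : Set (Fin n → R)))) :
    (coneRank R (fun v : V => homogenize (v : Fin n → R)) (faceLatticeOrderIso V F).1 : ℤ)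
      = setDim F.1 + 1 := by
  have h : setDim F.1 = setDim ((V : Set (Fin n → R)) ∩ F.1) := by
    conv_lhs => rw [F.2.eq_convexHull, setDim_convexHull]
  rw [coneRank_homogenize, h]
  congr 2
  ext x
  constructor
  · rintro ⟨v, hv, rfl⟩
    exact ⟨v.2, hv⟩
  · rintro ⟨hx, hxF⟩
    exact ⟨⟨x, hx⟩, hxF, rfl⟩

end Homogenize

theorem mainTheorem3 {R : Type*} [Field R] [LinearOrder R] [IsStrictOrderedRing R] {n : ℕ}
    {P : Set (Fin n → R)} (hP : IsPolytope P) :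
    (∀ F F' : FaceLattice P, F ≤ F' →
      setDim (F' : Set (Fin n → R)) = setDim (F : Set (Fin n → R)) + 2 →
        (Set.Ioo F F').ncard = 2 ∧ Nonempty (Set.Icc F F' ≃o Bool × Bool)) ∧
    (∀ F F' : FaceLattice P, Order.krullDim (Set.Icc F F') = 2 →
      Nonempty (Set.Icc F F' ≃o Bool × Bool)) := by
  obtain ⟨V, rfl⟩ := hP
  let e := faceLatticeOrderIso V
  let r : FaceLattice (convexHull R (V : Set (Fin n → R))) → ℕ := fun F =>
    coneRank R (fun v : V => homogenize (v : Fin n → R)) (e F).1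
  have hr : StrictMono r := fun F G h => (e F).2.coneRank_lt (e.strictMono h)
  have hrdim : ∀ F, (r F : ℤ) = setDim F.1 + 1 := coneRank_faceLatticeOrderIso V
  have hgap : ∀ F F', F ≤ F' → r F + 2 ≤ r F' → ∃ G, F < G ∧ G < F' := by
    intro F F' hle h
    obtain ⟨G, hG, h₁, h₂⟩ := (e F).2.exists_between (e F').2 (e.monotone hle) h
    exact ⟨e.symm ⟨G, hG⟩, e.lt_symm_apply.2 h₁, e.symm_apply_lt.2 h₂⟩
  have htwo : ∀ F F', F ≤ F' → r F' = r F + 2 →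
      (Set.Ioo F F').ncard = 2 ∧ Nonempty (Set.Icc F F' ≃o Bool × Bool) := by
    intro F F' hle h
    obtain ⟨G₁, G₂, hne, hG⟩ := (e F).2.exists_two_between (e F').2 (e.monotone hle) h
    have m₁ := (hG G₁).2 (Or.inl rfl)
    have m₂ := (hG G₂).2 (Or.inr rfl)
    have hIoo : Set.Ioo F F' = {e.symm ⟨G₁, m₁.1⟩, e.symm ⟨G₂, m₂.1⟩} := by
      ext G
      rw [Set.mem_insert_iff, Set.mem_singleton_iff, e.eq_symm_apply, e.eq_symm_apply,
        Subtype.ext_iff, Subtype.ext_iff, ← hG, Set.mem_Ioo, ← e.lt_iff_lt, ← e.lt_iff_lt (y := F')]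
      exact ⟨fun h => ⟨(e G).2, h⟩, fun h => h.2⟩
    have hne' : e.symm ⟨G₁, m₁.1⟩ ≠ e.symm ⟨G₂, m₂.1⟩ := fun h =>
      hne (congrArg Subtype.val (e.symm.injective h))
    -- Equal ranks make the two intermediate faces incomparable.
    have hrank : ∀ G ∈ Set.Ioo F F', r G = r F + 1 := by
      rintro G ⟨h₁, h₂⟩
      have := hr h₁
      have := hr h₂
      omega
    have r₁ := hrank (e.symm ⟨G₁, m₁.1⟩) (by simp [hIoo])
    have r₂ := hrank (e.symm ⟨G₂, m₂.1⟩) (by simp [hIoo])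
    refine ⟨by rw [hIoo, Set.ncard_pair hne'], nonempty_Icc_orderIso_bool_prod hIoo ?_ ?_⟩
    · intro hle
      have := hr (lt_of_le_of_ne hle hne')
      omega
    · intro hle
      have := hr (lt_of_le_of_ne hle hne'.symm)
      omega
  refine ⟨fun F F' hle h => htwo F F' hle ?_, fun F F' h => ?_⟩
  · have h₁ := hrdim F
    have h₂ := hrdim F'
    omega
  · obtain ⟨hle, h⟩ := rank_eq_add_two_of_krullDim_Icc_eq_two hr hgap h
    exact (htwo F F' hle h).2
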